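/- Let $\delta\in(-1,1)$, $\alpha\in(1,2)$, $\beta\in(0,1)$, $c\in(0,\infty)$, and let $\phi:\{0,1,2,\ldots\}\to[0,1]$ satisfy $\phi(n)=n^{-\beta}$ for all $n\ge 1$ (with $\phi(0)\in[0,1]$ arbitrary). On a probability space $(\Omega,\mathcal F,\mathbb P)$ let $\chi_0,\chi_1,\ldots$ be independent $\{0,1\}$-valued random variables with $\mathbb P[\chi_n=1]=\phi(n)$, and let $\xi_0,\xi_1,\ldots$ be i.i.d. $(0,1)$-valued random variables, the sequence $(\xi_n)$ being independent of the sequence $(\chi_n)$. Put $$p_n=\frac{1-\delta}{2}\,\chi_n+\xi_n(1-\chi_n),\qquad \zeta_n=\log\frac{\xi_n}{1-\xi_n}.$$ For a fixed realization $\omega=(p_0,p_1,\ldots)$ let $X=(X_t)_{t\ge 0}$ be the (irreducible) Markov chain on $\{0,1,2,\ldots\}$ that jumps from $n\ge1$ to $n-1$ with probability $p_n$ and to $n+1$ with probability $1-p_n$, and from $0$ stays at $0$ with probability $p_0$ and jumps to $1$ with probability $1-p_0$. The chain is called recurrent if from every state it returns to that state with probability $1$, and transient if from every state its probability of return is less than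 $1$. Assume that $\zeta_0$ is symmetric, i.e. $\mathbb P[\zeta_0\le -x]=\mathbb P[\zeta_0\ge x]$ for all $x\ge 0$, and that $\mathbb P[\zeta_0>r]\sim c\,r^{-\alpha}$ as $r\to\infty$ (the ratio of the two sides tends to $1$). (i) Suppose $\beta<1-\frac1\alpha$. If $\delta<0$, then $X$ is recurrent for $\mathbb P$-a.e. $\omega$. If $\delta>0$, then $X$ is transient for $\mathbb P$-a.e. $\omega$. (ii) Suppose $\beta>1-\frac1\alpha$. Then, for any $\delta\in(-1,1)$, $X$ is recurrent for $\mathbb P$-a.e. $\omega$. -/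

import Mathlib

open MeasureTheory ProbabilityTheory Filter Asymptotics

/-! ### Markov chains on the nonnegative integers -/

/-- The law on path space of the time-homogeneous Markov chain `X` on `ℕ` with one-step transition
kernel `K` and `X 0 = x`. -/
noncomputable def chainLaw (K : Kernel ℕ ℕ) [IsMarkovKernel K] (x : ℕ) : Measure (ℕ → ℕ) :=
  Kernel.traj (X := fun _ : ℕ => ℕ)
    (fun n => K.comap (fun h : (i : Finset.Iic n) → ℕ => h ⟨n, Finset.mem_Iic.2 le_rfl⟩)
      (measurable_pi_apply _))
    0 (fun _ => x)

/-- The probability that the chain started at `x` returns to `x` at some time `t ≥ 1`. -/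
noncomputable def returnProb (K : Kernel ℕ ℕ) [IsMarkovKernel K] (x : ℕ) : ENNReal :=
  chainLaw K x {X | ∃ t, 1 ≤ t ∧ X t = x}

/-- The chain is recurrent: from every state it returns with probability one. -/
def ChainRecurrent (K : Kernel ℕ ℕ) [IsMarkovKernel K] : Prop :=
  ∀ x, returnProb K x = 1

/-- The chain is transient: from every state, with positive probability it never returns. -/
def ChainTransient (K : Kernel ℕ ℕ) [IsMarkovKernel K] : Prop :=
  ∀ x, returnProb K x < 1

/-! ### The nearest-neighbour walk in a fixed environment -/

/-- One step of the walk in the environment `p`: from `n` to `n - 1` with probability `p n` and to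
`n + 1` with probability `1 - p n`; from `0` the walk stays put with probability `p 0`, which is
what the truncated subtraction `0 - 1 = 0` says. -/
noncomputable def walkKernel (p : ℕ → Set.Ioo (0 : ℝ) 1) : Kernel ℕ ℕ where
  toFun n := ENNReal.ofReal (p n) • Measure.dirac (n - 1)
    + ENNReal.ofReal (1 - p n) • Measure.dirac (n + 1)
  measurable' := measurable_of_countable _

instance walkKernel_isMarkovKernel (p : ℕ → Set.Ioo (0 : ℝ) 1) :
    IsMarkovKernel (walkKernel p) := by
  refine ⟨fun n => ⟨?_⟩⟩
  have h := (p n).2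
  change (ENNReal.ofReal (p n) • Measure.dirac (n - 1)
    + ENNReal.ofReal (1 - p n) • Measure.dirac (n + 1) : Measure ℕ) Set.univ = 1
  simp only [Measure.add_apply, Measure.smul_apply, measure_univ, smul_eq_mul, mul_one]
  rw [← ENNReal.ofReal_add h.1.le (by linarith [h.2])]
  simp

/-! ### The random environment -/

/-- The jump probability `((1 - δ) / 2) χ + ξ (1 - χ)` at a site. -/
noncomputable def siteProb (δ : Set.Ioo (-1 : ℝ) 1) (χ : ({0, 1} : Set ℝ))
    (ξ : Set.Ioo (0 : ℝ) 1) : Set.Ioo (0 : ℝ) 1 :=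
  ⟨((1 - (δ : ℝ)) / 2) * (χ : ℝ) + (ξ : ℝ) * (1 - (χ : ℝ)), by
    obtain ⟨d, hd1, hd2⟩ := δ
    obtain ⟨u, hu1, hu2⟩ := ξ
    obtain ⟨k, hk⟩ := χ
    rcases hk with rfl | hk
    · constructor <;> simpa
    · obtain rfl : k = 1 := hk
      constructor <;> simp only [] <;> linarith⟩

/-- The logarithm of the odds, `log (u / (1 - u))`. -/
noncomputable def logOdds (u : Set.Ioo (0 : ℝ) 1) : ℝ :=
  Real.log ((u : ℝ) / (1 - (u : ℝ)))

/-!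
For a fixed environment the walk has the harmonic function with increments
`∏ 1 ≤ k ≤ n, p k / (1 - p k) = exp (S n)`, where `S n` is the sum of the log-odds of `p` over the
sites `1, …, n`. The walk is recurrent when `∑ exp (S n)` diverges and transient when it converges
(`chainRecurrent_of_not_summable`, `chainTransient_of_summable`); both come from the Markov property
at time one (`chainLaw_map_shift`), applied to the probability of visiting a given state.

In the random environment, call a site `k` fast if `χ k = 1` and slow otherwise. Then `S n` is the
sum over the slow points of the symmetric variables `ζ`, which is of order `n ^ (1 / α)`, minus
`log ((1 + δ) / (1 - δ))` times the number of fast points, which is of order `n ^ (1 - β)`.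

If `1 - β > 1 / α`, the drift wins. Since `ζ` has moments of all orders below `α`, truncation,
Chernoff's bound and the Borel-Cantelli lemma show that `S n` is almost surely beyond a multiple of
`n ^ (1 - β)`, with the sign of `-δ` (`ae_eventually_sum_le_of_drift`).

If `1 - β < 1 / α`, the jumps win. Convergence of `∑ exp (S n)` is a tail event
(`measure_summable_exp_sum_zero_or_one`). Were it almost sure, then by symmetry it would also hold
with all `ζ` reflected, so that the symmetric part of `S n` would be at most a multiple of the
number of fast points in absolute value. Then the jumps at the slow points would be eventually
smaller than `n ^ η` for some `η < 1 / α`, which the second Borel-Cantelli lemma excludes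
(`ae_not_summable_exp_of_jumps`).
-/

/-! ### The Markov property at time one -/

instance chainLaw_isProbabilityMeasure (K : Kernel ℕ ℕ) [IsMarkovKernel K] (x : ℕ) :
    IsProbabilityMeasure (chainLaw K x) := by
  unfold chainLaw; infer_instance

/-- The cylinder of trajectories which agree with `s` up to time `n`. -/
def pathCylinder (n : ℕ) (s : ℕ → ℕ) : Set (ℕ → ℕ) := {X | ∀ i ≤ n, X i = s i}

lemma measurableSet_pathCylinder (n : ℕ) (s : ℕ → ℕ) : MeasurableSet (pathCylinder n s) := by
  have : pathCylinder n s = ⋂ i ∈ Finset.Iic n, (fun X : ℕ → ℕ => X i) ⁻¹' {s i} := by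
    ext X; simp [pathCylinder]
  rw [this]
  exact Finset.measurableSet_biInter _ fun i _ => measurable_pi_apply i (measurableSet_singleton _)

lemma chainLaw_pathCylinder_zero (K : Kernel ℕ ℕ) [IsMarkovKernel K] (x : ℕ) (s : ℕ → ℕ) :
    chainLaw K x (pathCylinder 0 s) = if x = s 0 then 1 else 0 := by
  have h := Kernel.traj_map_frestrictLe_apply (X := fun _ : ℕ => ℕ)
    (κ := fun n => K.comap (fun h : (i : Finset.Iic n) → ℕ => h ⟨n, Finset.mem_Iic.2 le_rfl⟩)
      (measurable_pi_apply _)) 0 0 (fun _ => x)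
  have hS : MeasurableSet {h : (i : Finset.Iic 0) → ℕ | h ⟨0, by simp⟩ = s 0} :=
    measurable_pi_apply _ (measurableSet_singleton _)
  have : pathCylinder 0 s = Preorder.frestrictLe (π := fun _ => ℕ) 0 ⁻¹'
      {h : (i : Finset.Iic 0) → ℕ | h ⟨0, by simp⟩ = s 0} := by
    ext X; simp [pathCylinder]
  rw [this, ← Measure.map_apply (by fun_prop) hS, chainLaw, h, Kernel.partialTraj_self,
    Kernel.id_apply, Measure.dirac_apply' _ hS]
  simp [Set.indicator]

/-- One more coordinate multiplies the probability of a cylinder by a transition probability. -/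
lemma chainLaw_pathCylinder_succ (K : Kernel ℕ ℕ) [IsMarkovKernel K] (x n : ℕ) (s : ℕ → ℕ) :
    chainLaw K x (pathCylinder (n + 1) s) =
      chainLaw K x (pathCylinder n s) * K (s n) {s (n + 1)} := by
  have h := Kernel.partialTraj_compProd_eq_map_traj (X := fun _ : ℕ => ℕ)
    (κ := fun n => K.comap (fun h : (i : Finset.Iic n) → ℕ => h ⟨n, Finset.mem_Iic.2 le_rfl⟩)
      (measurable_pi_apply _)) (Nat.zero_le n) (x₀ := fun _ => x)
  rw [← Kernel.traj_map_frestrictLe_apply] at h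
  set S : Set ((i : Finset.Iic n) → ℕ) := {h | ∀ i, h i = s i} with hSdef
  have hS : MeasurableSet S := by
    have : S = ⋂ i : Finset.Iic n, (fun h : (i : Finset.Iic n) → ℕ => h i) ⁻¹' {s i} := by
      ext; simp [hSdef]
    rw [this]
    exact MeasurableSet.iInter fun i => measurable_pi_apply i (measurableSet_singleton _)
  have hn : pathCylinder n s = Preorder.frestrictLe (π := fun _ => ℕ) n ⁻¹' S := by
    ext X; simp [pathCylinder, hSdef]
  have hn1 : pathCylinder (n + 1) s =
      (fun X : ℕ → ℕ => (Preorder.frestrictLe (π := fun _ => ℕ) n X, X (n + 1))) ⁻¹'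
        (S ×ˢ {s (n + 1)}) := by
    ext X
    simp only [pathCylinder, hSdef, Set.mem_ofPred_eq, Set.mem_preimage, Set.mem_prod,
      Set.mem_singleton_iff, Nat.le_succ_iff]
    constructor
    · intro hX
      exact ⟨fun i => hX _ (Or.inl (Finset.mem_Iic.1 i.2)), hX _ (Or.inr rfl)⟩
    · rintro ⟨h1, h2⟩ i (hi | rfl)
      · exact h1 ⟨i, Finset.mem_Iic.2 hi⟩
      · exact h2
  rw [hn1, hn, chainLaw, ← Measure.map_apply (by fun_prop) (hS.prod (measurableSet_singleton _)),
    ← h, Measure.compProd_apply_prod hS (measurableSet_singleton _),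
    ← Measure.map_apply (by fun_prop) hS]
  rw [setLIntegral_congr_fun (g := fun _ => K (s n) {s (n + 1)}) hS]
  · rw [setLIntegral_const, mul_comm]
  · intro y hy
    simp only [Kernel.comap_apply]
    rw [hy]

/-- The Markov property at time one: the trajectory after the first step is that of the chain
restarted at a point chosen by the kernel. -/
lemma chainLaw_map_shift (K : Kernel ℕ ℕ) [IsMarkovKernel K] (x : ℕ) :
    (chainLaw K x).map (fun X n => X (n + 1)) =
      Measure.sum fun z => K x {z} • chainLaw K z := by
  have hm : Measurable fun (X : ℕ → ℕ) n => X (n + 1) := by fun_prop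
  have hprob : IsProbabilityMeasure ((chainLaw K x).map (fun X n => X (n + 1))) :=
    Measure.isProbabilityMeasure_map hm.aemeasurable
  have hcyl : ∀ n s, (chainLaw K x).map (fun X n => X (n + 1)) (pathCylinder n s) =
      (Measure.sum fun z => K x {z} • chainLaw K z) (pathCylinder n s) := by
    intro n s
    -- Almost surely `X 0 = x`, so the preimage is the cylinder of `s` preceded by `x`.
    set s' : ℕ → ℕ := fun i => if i = 0 then x else s (i - 1) with hs'
    have hae : (fun X : ℕ → ℕ => fun n => X (n + 1)) ⁻¹' pathCylinder n s ∩ pathCylinder 0 s' =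
        pathCylinder (n + 1) s' := by
      ext X
      simp only [pathCylinder, Set.mem_inter_iff, Set.mem_preimage, Set.mem_ofPred_eq, hs']
      constructor
      · rintro ⟨h1, h2⟩ i hi
        rcases i with _ | i
        · exact h2 0 le_rfl
        · simpa using h1 i (by omega)
      · intro h
        refine ⟨fun i hi => by simpa using h (i + 1) (by omega), fun i hi => h i (by omega)⟩
    have h0 : chainLaw K x (pathCylinder 0 s')ᶜ = 0 := by
      rw [prob_compl_eq_zero_iff (measurableSet_pathCylinder _ _), chainLaw_pathCylinder_zero]
      simp [hs']
    rw [Measure.map_apply hm (measurableSet_pathCylinder _ _),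
      ← measure_inter_add_sdiff _ (measurableSet_pathCylinder 0 s'), hae,
      measure_mono_null (s := _ \ _) (fun _ h => h.2) h0, add_zero,
      Measure.sum_apply _ (measurableSet_pathCylinder _ _)]
    simp only [Measure.smul_apply, smul_eq_mul]
    clear hae
    induction n with
    | zero =>
      rw [chainLaw_pathCylinder_succ, chainLaw_pathCylinder_zero]
      simp only [chainLaw_pathCylinder_zero]
      simp [hs']
    | succ n ih =>
      rw [chainLaw_pathCylinder_succ, ih]
      simp only [chainLaw_pathCylinder_succ K _ n s, ← mul_assoc]
      rw [ENNReal.tsum_mul_right]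
      simp [hs']
  refine ext_of_generate_finite (insert ∅ {C | ∃ n s, C = pathCylinder n s}) ?_ ?_ ?_ ?_
  · refine le_antisymm ?_ (MeasurableSpace.generateFrom_le ?_)
    · refine iSup_le fun i => ?_
      rw [MeasurableSpace.comap_le_iff_le_map]
      intro A _
      have : (fun X : ℕ → ℕ => X i) ⁻¹' A =
          ⋃ h ∈ {h : Fin (i + 1) → ℕ | h (Fin.last i) ∈ A},
            pathCylinder i (fun j => if hj : j < i + 1 then h ⟨j, hj⟩ else 0) := by
        ext X
        simp only [Set.mem_preimage, Set.mem_iUnion, Set.mem_ofPred_eq, pathCylinder, exists_prop]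
        constructor
        · intro hX
          refine ⟨fun j => X j, hX, fun j hj => ?_⟩
          simp [Nat.lt_succ_of_le hj]
        · rintro ⟨h, hA, hX⟩
          have := hX i le_rfl
          simp only [Nat.lt_succ_self, dite_true] at this
          rw [this]; exact hA
      rw [MeasurableSpace.map_def, this]
      refine MeasurableSet.biUnion (Set.to_countable _) fun h _ => ?_
      exact MeasurableSpace.measurableSet_generateFrom (Or.inr ⟨_, _, rfl⟩)
    · rintro C (rfl | ⟨n, s, rfl⟩)
      · exact MeasurableSet.empty
      · exact measurableSet_pathCylinder n s
  · rintro _ (rfl | ⟨n, s, rfl⟩) _ (rfl | ⟨m, t, rfl⟩) hne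
    · simp
    · simp
    · simp
    · right
      obtain ⟨Y, hY1, hY2⟩ := hne
      refine ⟨max n m, Y, ?_⟩
      ext X
      simp only [pathCylinder, Set.mem_inter_iff, Set.mem_ofPred_eq] at hY1 hY2 ⊢
      constructor
      · rintro ⟨h1, h2⟩ i hi
        rcases le_max_iff.1 hi with h | h
        · rw [h1 i h, hY1 i h]
        · rw [h2 i h, hY2 i h]
      · intro h
        exact ⟨fun i hi => (h i (hi.trans (le_max_left _ _))).trans (hY1 i hi),
          fun i hi => (h i (hi.trans (le_max_right _ _))).trans (hY2 i hi)⟩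
  · rintro C (rfl | ⟨n, s, rfl⟩)
    · simp
    · exact hcyl n s
  · rw [measure_univ, Measure.sum_apply _ MeasurableSet.univ]
    simp only [Measure.smul_apply, measure_univ, smul_eq_mul, mul_one]
    rw [← measure_univ (μ := K x), ← Measure.tsum_indicator_apply_singleton _ _ MeasurableSet.univ]
    simp

/-! ### A recurrence criterion for nearest-neighbour walks -/

/-- First-step analysis of the walk. At `0` the truncated `0 - 1 = 0` matches the reflection. -/
lemma chainLaw_shift_preimage (p : ℕ → Set.Ioo (0 : ℝ) 1) (x : ℕ) {A : Set (ℕ → ℕ)}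
    (hA : MeasurableSet A) :
    (chainLaw (walkKernel p) x).real ((fun X n => X (n + 1)) ⁻¹' A) =
      p x * (chainLaw (walkKernel p) (x - 1)).real A +
        (1 - p x) * (chainLaw (walkKernel p) (x + 1)).real A := by
  have hm : Measurable fun (X : ℕ → ℕ) n => X (n + 1) := by fun_prop
  have h0 := (p x).2.1
  have h1 := (p x).2.2
  have key : chainLaw (walkKernel p) x ((fun X n => X (n + 1)) ⁻¹' A) =
      ENNReal.ofReal (p x) * chainLaw (walkKernel p) (x - 1) A +
        ENNReal.ofReal (1 - p x) * chainLaw (walkKernel p) (x + 1) A := by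
    rw [← Measure.map_apply hm hA, chainLaw_map_shift, Measure.sum_apply _ hA]
    simp only [Measure.smul_apply, smul_eq_mul]
    have := lintegral_countable' (μ := walkKernel p x) (fun z => chainLaw (walkKernel p) z A)
    simp only [mul_comm (walkKernel p x _)]
    rw [← this]
    change ∫⁻ z, chainLaw (walkKernel p) z A ∂(ENNReal.ofReal (p x) • Measure.dirac (x - 1)
      + ENNReal.ofReal (1 - p x) • Measure.dirac (x + 1) : Measure ℕ) = _
    rw [lintegral_add_measure, lintegral_smul_measure, lintegral_smul_measure, lintegral_dirac,
      lintegral_dirac, smul_eq_mul, smul_eq_mul]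
  rw [measureReal_def, key, ENNReal.toReal_add (by finiteness) (by finiteness), ENNReal.toReal_mul,
    ENNReal.toReal_mul, ENNReal.toReal_ofReal h0.le, ENNReal.toReal_ofReal (by linarith)]
  rfl

lemma ae_chainLaw_zero (K : Kernel ℕ ℕ) [IsMarkovKernel K] (x : ℕ) :
    ∀ᵐ X ∂chainLaw K x, X 0 = x := by
  have : {X : ℕ → ℕ | X 0 = x} = pathCylinder 0 (fun _ => x) := by ext; simp [pathCylinder]
  rw [ae_iff_prob_eq_one (by measurability), this, chainLaw_pathCylinder_zero]
  simp

/-- The event that the trajectory visits `x`. -/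
def visits (x : ℕ) : Set (ℕ → ℕ) := {X | ∃ t, X t = x}

/-- The event that the trajectory visits `x` by time `T`. -/
def visitsBy (x T : ℕ) : Set (ℕ → ℕ) := {X | ∃ t ≤ T, X t = x}

lemma measurableSet_visitsBy (x T : ℕ) : MeasurableSet (visitsBy x T) := by
  have : visitsBy x T = ⋃ t ∈ Finset.Iic T, (fun X : ℕ → ℕ => X t) ⁻¹' {x} := by
    ext X; simp [visitsBy]
  rw [this]
  exact Finset.measurableSet_biUnion _ fun i _ => measurable_pi_apply i (measurableSet_singleton _)

lemma visits_eq_iUnion (x : ℕ) : visits x = ⋃ T, visitsBy x T := by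
  ext X
  simp only [visits, visitsBy, Set.mem_iUnion, Set.mem_ofPred_eq]
  exact ⟨fun ⟨t, h⟩ => ⟨t, t, le_rfl, h⟩, fun ⟨_, t, _, h⟩ => ⟨t, h⟩⟩

lemma measurableSet_visits (x : ℕ) : MeasurableSet (visits x) := by
  rw [visits_eq_iUnion]
  exact MeasurableSet.iUnion fun T => measurableSet_visitsBy x T

lemma chainLaw_visits_self (K : Kernel ℕ ℕ) [IsMarkovKernel K] (x : ℕ) :
    (chainLaw K x).real (visits x) = 1 := by
  rw [measureReal_def, ENNReal.toReal_eq_one_iff]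
  rw [← mem_ae_iff_prob_eq_one (measurableSet_visits x)]
  filter_upwards [ae_chainLaw_zero K x] with X hX using ⟨0, hX⟩

/-- Off `x` the probability of ever visiting `x` is harmonic. -/
lemma chainLaw_visits_of_ne (p : ℕ → Set.Ioo (0 : ℝ) 1) {x z : ℕ} (hz : z ≠ x) :
    (chainLaw (walkKernel p) z).real (visits x) =
      p z * (chainLaw (walkKernel p) (z - 1)).real (visits x) +
        (1 - p z) * (chainLaw (walkKernel p) (z + 1)).real (visits x) := by
  rw [← chainLaw_shift_preimage p z (measurableSet_visits x)]
  refine measureReal_congr ?_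
  filter_upwards [ae_chainLaw_zero (walkKernel p) z] with X hX
  refine propext ⟨?_, ?_⟩
  · rintro ⟨_ | t, ht⟩
    · exact absurd (hX.symm.trans ht) hz
    · exact ⟨t, ht⟩
  · rintro ⟨t, ht⟩
    exact ⟨t + 1, ht⟩

lemma chainLaw_visitsBy_succ_of_ne (p : ℕ → Set.Ioo (0 : ℝ) 1) {x z : ℕ} (T : ℕ) (hz : z ≠ x) :
    (chainLaw (walkKernel p) z).real (visitsBy x (T + 1)) =
      p z * (chainLaw (walkKernel p) (z - 1)).real (visitsBy x T) +
        (1 - p z) * (chainLaw (walkKernel p) (z + 1)).real (visitsBy x T) := by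
  rw [← chainLaw_shift_preimage p z (measurableSet_visitsBy x T)]
  refine measureReal_congr ?_
  filter_upwards [ae_chainLaw_zero (walkKernel p) z] with X hX
  refine propext ⟨?_, ?_⟩
  · rintro ⟨_ | t, hT, ht⟩
    · exact absurd (hX.symm.trans ht) hz
    · exact ⟨t, by omega, ht⟩
  · rintro ⟨t, hT, ht⟩
    exact ⟨t + 1, by omega, ht⟩

lemma chainLaw_visitsBy_zero_of_ne (K : Kernel ℕ ℕ) [IsMarkovKernel K] {x z : ℕ} (hz : z ≠ x) :
    (chainLaw K z).real (visitsBy x 0) = 0 := by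
  rw [measureReal_def, ENNReal.toReal_eq_zero_iff]
  left
  rw [← compl_compl (visitsBy x 0), ← mem_ae_iff]
  filter_upwards [ae_chainLaw_zero K z] with X hX
  rintro ⟨t, ht, h⟩
  obtain rfl : t = 0 := by omega
  exact hz (hX.symm.trans h)

lemma returnProb_walkKernel (p : ℕ → Set.Ioo (0 : ℝ) 1) (x : ℕ) :
    (returnProb (walkKernel p) x).toReal =
      p x * (chainLaw (walkKernel p) (x - 1)).real (visits x) +
        (1 - p x) * (chainLaw (walkKernel p) (x + 1)).real (visits x) := by
  rw [← chainLaw_shift_preimage p x (measurableSet_visits x), returnProb, measureReal_def]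
  congr 2
  ext X
  constructor
  · rintro ⟨_ | t, h1, ht⟩
    · omega
    · exact ⟨t, ht⟩
  · rintro ⟨t, ht⟩
    exact ⟨t + 1, by omega, ht⟩

lemma returnProb_ne_top (K : Kernel ℕ ℕ) [IsMarkovKernel K] (x : ℕ) : returnProb K x ≠ ⊤ :=
  measure_ne_top _ _

/-- The product `∏ k < n, p (k + 1) / (1 - p (k + 1))`, the `n`-th increment of the harmonic
function of the walk killed at `0`, written as the exponential of the potential. -/
noncomputable def expPotential (p : ℕ → Set.Ioo (0 : ℝ) 1) (n : ℕ) : ℝ :=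
  Real.exp (∑ k ∈ Finset.range n, logOdds (p (k + 1)))

lemma expPotential_pos (p : ℕ → Set.Ioo (0 : ℝ) 1) (n : ℕ) : 0 < expPotential p n :=
  Real.exp_pos _

lemma expPotential_succ (p : ℕ → Set.Ioo (0 : ℝ) 1) (n : ℕ) :
    (1 - (p (n + 1) : ℝ)) * expPotential p (n + 1) = p (n + 1) * expPotential p n := by
  have h0 := (p (n + 1)).2.1
  have h1 : 0 < 1 - (p (n + 1) : ℝ) := by linarith [(p (n + 1)).2.2]
  rw [expPotential, Finset.sum_range_succ, Real.exp_add, logOdds, Real.exp_log (by positivity),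
    expPotential]
  field_simp

/-- A function that is harmonic above `x` has increments proportional to `expPotential` from `x`
on. -/
lemma sub_eq_of_harmonic (p : ℕ → Set.Ioo (0 : ℝ) 1) (g : ℕ → ℝ) (x : ℕ)
    (hg : ∀ z, x < z → g z = p z * g (z - 1) + (1 - p z) * g (z + 1)) (n : ℕ) :
    (g (x + n + 1) - g (x + n)) * expPotential p x =
      (g (x + 1) - g x) * expPotential p (x + n) := by
  induction n with
  | zero => simp
  | succ n ih =>
    have h1 := hg (x + n + 1) (by omega)
    have h2 := expPotential_succ p (x + n)
    have h3 : 0 < 1 - (p (x + n + 1) : ℝ) := by linarith [(p (x + n + 1)).2.2]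
    simp only [Nat.add_sub_cancel] at h1
    rw [← add_assoc]
    refine mul_left_cancel₀ h3.ne' ?_
    linear_combination (g (x + 1) - g x) * (-h2) + (p (x + n + 1) : ℝ) * ih
      - expPotential p x * h1

/-- The walk is recurrent when the harmonic function of the walk killed at `0` is unbounded: above
`x` the probability of visiting `x` is an affine function of that harmonic function, so it must be
constant, and below `x` it is constant by the reflection at `0`. -/
theorem chainRecurrent_of_not_summable (p : ℕ → Set.Ioo (0 : ℝ) 1)
    (hp : ¬ Summable (expPotential p)) : ChainRecurrent (walkKernel p) := by
  intro x
  set H : ℕ → ℝ := fun z => (chainLaw (walkKernel p) z).real (visits x) with hH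
  have hH0 : ∀ z, 0 ≤ H z := fun z => measureReal_nonneg
  have hH1 : ∀ z, H z ≤ 1 := fun z => measureReal_le_one
  have hHx : H x = 1 := chainLaw_visits_self _ _
  have harm : ∀ z, z ≠ x → H z = p z * H (z - 1) + (1 - p z) * H (z + 1) :=
    fun z hz => chainLaw_visits_of_ne p hz
  have habove : H (x + 1) = 1 := by
    by_contra hne
    have hlt : H (x + 1) - H x < 0 := by
      rw [hHx]; linarith [lt_of_le_of_ne (hH1 (x + 1)) hne]
    have hinc := sub_eq_of_harmonic p H x fun z hz => harm z hz.ne'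
    apply hp
    rw [← summable_nat_add_iff x]
    refine summable_of_sum_range_le (c := expPotential p x / (H x - H (x + 1)))
      (fun n => (expPotential_pos p _).le) fun n => ?_
    rw [le_div_iff₀ (by linarith)]
    have : (∑ i ∈ Finset.range n, expPotential p (i + x)) * (H x - H (x + 1)) =
        (H x - H (x + n)) * expPotential p x := by
      induction n with
      | zero => simp
      | succ n ih =>
        rw [Finset.sum_range_succ, add_mul, ih, add_comm n x, ← add_assoc]
        linear_combination hinc n
    rw [this]
    refine mul_le_of_le_one_left (expPotential_pos p x).le ?_
    linarith [hH0 (x + n)]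
  have hbelow : H (x - 1) = 1 := by
    have hconst : ∀ z, z ≤ x → H z = H 0 ∧ H (z - 1) = H 0 := by
      intro z
      induction z with
      | zero => simp
      | succ z ih =>
        intro hz
        obtain ⟨h1, h2⟩ := ih (by omega)
        refine ⟨?_, h1⟩
        have h := harm z (by omega)
        have h3 : 0 < 1 - (p z : ℝ) := by linarith [(p z).2.2]
        rw [h1, h2] at h
        refine mul_left_cancel₀ h3.ne' ?_
        linarith
    rw [(hconst x le_rfl).2, ← (hconst x le_rfl).1, hHx]
  have h := returnProb_walkKernel p x
  change _ = p x * H (x - 1) + (1 - p x) * H (x + 1) at h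
  rw [habove, hbelow] at h
  rw [← ENNReal.toReal_eq_one_iff, h]
  ring

/-- The walk is transient when the harmonic function of the walk killed at `0` is bounded: above
`x` the normalized tail sums of `expPotential` are harmonic and dominate the probability of visiting
`x`, and they are less than one at `x + 1`. -/
theorem chainTransient_of_summable (p : ℕ → Set.Ioo (0 : ℝ) 1)
    (hp : Summable (expPotential p)) : ChainTransient (walkKernel p) := by
  intro x
  set r : ℕ → ℝ := fun z => ∑' j, expPotential p (j + z) with hr
  have hsum : ∀ z, Summable fun j => expPotential p (j + z) := fun z =>
    (summable_nat_add_iff z).2 hp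
  have hrpos : ∀ z, 0 < r z := fun z =>
    (hsum z).tsum_pos (fun j => (expPotential_pos p _).le) 0 (expPotential_pos p _)
  have hrsucc : ∀ z, r z = expPotential p z + r (z + 1) := by
    intro z
    rw [hr]
    simp only
    rw [(hsum z).tsum_eq_zero_add, zero_add]
    congr 2
    ext j
    congr 1
    ring
  have hbound : ∀ T z, x ≤ z → (chainLaw (walkKernel p) z).real (visitsBy x T) ≤ r z / r x := by
    intro T
    induction T with
    | zero =>
      intro z hz
      rcases hz.eq_or_lt with rfl | hlt
      · rw [div_self (hrpos x).ne']; exact measureReal_le_one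
      · rw [chainLaw_visitsBy_zero_of_ne _ hlt.ne']
        exact (div_pos (hrpos _) (hrpos _)).le
    | succ T ih =>
      intro z hz
      rcases hz.eq_or_lt with rfl | hlt
      · rw [div_self (hrpos x).ne']; exact measureReal_le_one
      · obtain ⟨w, rfl⟩ : ∃ w, z = w + 1 := ⟨z - 1, by omega⟩
        rw [chainLaw_visitsBy_succ_of_ne p T hlt.ne', Nat.add_sub_cancel]
        have h0 := (p (w + 1)).2.1
        have h1 : 0 < 1 - (p (w + 1) : ℝ) := by linarith [(p (w + 1)).2.2]
        refine (add_le_add (mul_le_mul_of_nonneg_left (ih w (by omega)) h0.le)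
          (mul_le_mul_of_nonneg_left (ih (w + 1 + 1) (by omega)) h1.le)).trans_eq ?_
        have e1 := hrsucc w
        have e2 := hrsucc (w + 1)
        have e3 := expPotential_succ p w
        have hx := (hrpos x).ne'
        field_simp
        linear_combination (p (w + 1) : ℝ) * e1 - (1 - (p (w + 1) : ℝ)) * e2 - e3
  have hvis : (chainLaw (walkKernel p) (x + 1)).real (visits x) ≤ r (x + 1) / r x := by
    have hmono : Monotone (visitsBy x) := fun S T hST X ⟨t, ht, h⟩ => ⟨t, ht.trans hST, h⟩
    have := tendsto_measure_iUnion_atTop (μ := chainLaw (walkKernel p) (x + 1)) hmono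
    rw [← visits_eq_iUnion] at this
    exact le_of_tendsto ((ENNReal.tendsto_toReal (measure_ne_top _ _)).comp this)
      (Eventually.of_forall fun T => hbound T (x + 1) (by omega))
  have hlt : r (x + 1) / r x < 1 := by
    rw [div_lt_one (hrpos x), hrsucc x]
    linarith [expPotential_pos p x]
  have h0 := (p x).2.1
  have h1 : 0 < 1 - (p x : ℝ) := by linarith [(p x).2.2]
  have hle : (chainLaw (walkKernel p) (x - 1)).real (visits x) ≤ 1 := measureReal_le_one
  rw [← ENNReal.toReal_lt_toReal (returnProb_ne_top _ _) ENNReal.one_ne_top, ENNReal.toReal_one,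
    returnProb_walkKernel]
  nlinarith [mul_lt_mul_of_pos_left (hvis.trans_lt hlt) h1]

/-! ### Independent pairs, symmetric laws and moments -/

lemma summable_exp_neg_mul_rpow {b s : ℝ} (hb : 0 < b) (hs : 0 < s) :
    Summable fun n : ℕ => Real.exp (-b * (n : ℝ) ^ s) := by
  have h1 : Tendsto (fun n : ℕ => (n : ℝ) ^ s) atTop atTop :=
    (tendsto_rpow_atTop hs).comp tendsto_natCast_atTop_atTop
  have h2 := ((isLittleO_exp_neg_mul_rpow_atTop hb (-2 / s)).comp_tendsto h1).isBigO
  refine summable_of_isBigO_nat (g := fun n : ℕ => (n : ℝ) ^ (-2 : ℝ)) ?_ ?_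
  · exact Real.summable_nat_rpow.2 (by norm_num)
  · refine h2.congr_right fun n => ?_
    simp only [Function.comp]
    rw [← Real.rpow_mul (Nat.cast_nonneg n)]
    congr 1
    field_simp

section

variable {Ω : Type*} [MeasurableSpace Ω] {P : Measure Ω}

/-- Two mutually independent sequences, each with independent entries, have independent pairs. -/
lemma iIndepFun_prodMk {E F : Type*} [MeasurableSpace E] [MeasurableSpace F]
    {X : ℕ → Ω → E} {Y : ℕ → Ω → F} (hX : iIndepFun X P) (hY : iIndepFun Y P)
    (hXm : ∀ n, Measurable (X n)) (hYm : ∀ n, Measurable (Y n))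
    (hXY : IndepFun (fun ω n => X n ω) (fun ω n => Y n ω) P) :
    iIndepFun (fun n ω => (X n ω, Y n ω)) P := by
  have hrect : ∀ S : Finset ℕ, ∀ A : ℕ → Set E, ∀ B : ℕ → Set F,
      (∀ i ∈ S, MeasurableSet (A i)) → (∀ i ∈ S, MeasurableSet (B i)) →
      P (⋂ i ∈ S, X i ⁻¹' A i ∩ Y i ⁻¹' B i) =
        ∏ i ∈ S, P (X i ⁻¹' A i) * P (Y i ⁻¹' B i) := by
    intro S A B hA hB
    have h1 : (⋂ i ∈ S, X i ⁻¹' A i ∩ Y i ⁻¹' B i) =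
        (fun ω n => X n ω) ⁻¹' (⋂ i ∈ S, (fun f : ℕ → E => f i) ⁻¹' A i) ∩
        (fun ω n => Y n ω) ⁻¹' (⋂ i ∈ S, (fun f : ℕ → F => f i) ⁻¹' B i) := by
      ext ω
      simp only [Set.mem_iInter, Set.mem_inter_iff, Set.mem_preimage]
      exact ⟨fun h => ⟨fun i hi => (h i hi).1, fun i hi => (h i hi).2⟩,
        fun h i hi => ⟨h.1 i hi, h.2 i hi⟩⟩
    rw [h1, hXY.measure_inter_preimage_eq_mul _ _
      (Finset.measurableSet_biInter _ fun i hi => measurable_pi_apply i (hA i hi))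
      (Finset.measurableSet_biInter _ fun i hi => measurable_pi_apply i (hB i hi)),
      Finset.prod_mul_distrib, ← hX.measure_inter_preimage_eq_mul S hA,
      ← hY.measure_inter_preimage_eq_mul S hB]
    congr 2 <;> ext ω <;> simp
  refine iIndepSets.iIndep (fun i => ((hXm i).prodMk (hYm i)).comap_le)
    (fun i => {s | ∃ t ∈ Set.image2 (· ×ˢ ·) {s : Set E | MeasurableSet s}
      {t : Set F | MeasurableSet t}, (fun ω => (X i ω, Y i ω)) ⁻¹' t = s})
    (fun i => isPiSystem_prod.comap _) (fun i => ?_) ?_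
  · change MeasurableSpace.comap _ Prod.instMeasurableSpace = _
    rw [← generateFrom_prod, MeasurableSpace.comap_generateFrom]
    rfl
  · rw [iIndepSets_iff]
    intro S f hf
    choose! g hg hgf using hf
    choose! A hA B hB hAB using hg
    have he : ∀ i ∈ S, f i = X i ⁻¹' A i ∩ Y i ⁻¹' B i := by
      intro i hi
      rw [← hgf i hi, ← hAB i hi]
      rfl
    have h2 : ∀ i ∈ S, P (f i) = P (X i ⁻¹' A i) * P (Y i ⁻¹' B i) := by
      intro i hi
      have := hrect {i} A B (by simpa using hA i hi) (by simpa using hB i hi)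
      simpa [he i hi] using this
    rw [Set.iInter₂_congr he, hrect S A B hA hB, Finset.prod_congr rfl h2]

variable [IsProbabilityMeasure P]

/-- A nonnegative variable with a tail of order `r ^ (-α)` has finite moments of order below `α`. -/
lemma integrable_rpow_of_tail {X : Ω → ℝ} (hX : Measurable X) (hX0 : ∀ ω, 0 ≤ X ω)
    {α q C : ℝ} (hq : 0 < q) (hqα : q < α)
    (htail : ∀ᶠ r : ℝ in atTop, P.real {ω | r < X ω} ≤ C * r ^ (-α)) :
    Integrable (fun ω => X ω ^ q) P := by
  obtain ⟨R, hR0, hR⟩ : ∃ R : ℝ, 0 < R ∧ ∀ r, R ≤ r → P.real {ω | r < X ω} ≤ C * r ^ (-α) := by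
    obtain ⟨R, hR⟩ := eventually_atTop.1 htail
    exact ⟨max R 1, by positivity, fun r hr => hR r ((le_max_left _ _).trans hr)⟩
  refine ⟨(hX.pow_const q).aestronglyMeasurable, ?_⟩
  rw [hasFiniteIntegral_iff_ofReal (Eventually.of_forall fun ω => Real.rpow_nonneg (hX0 ω) q),
    lintegral_rpow_eq_lintegral_meas_lt_mul P (Eventually.of_forall hX0) hX.aemeasurable hq]
  refine ENNReal.mul_lt_top ENNReal.ofReal_lt_top ?_
  rw [← Set.Ioc_union_Ioi_eq_Ioi hR0.le]
  refine (lintegral_union_le _ _ _).trans_lt (ENNReal.add_lt_top.2 ⟨?_, ?_⟩)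
  · have hint : IntegrableOn (fun t : ℝ => t ^ (q - 1)) (Set.Ioc 0 R) := by
      rw [← intervalIntegrable_iff_integrableOn_Ioc_of_le hR0.le]
      exact intervalIntegral.intervalIntegrable_rpow' (by linarith)
    refine lt_of_le_of_lt (setLIntegral_mono_ae' measurableSet_Ioc
      (g := fun t => ENNReal.ofReal (t ^ (q - 1))) ?_) hint.lintegral_lt_top
    exact Eventually.of_forall fun t _ => mul_le_of_le_one_left' prob_le_one
  · have hint : IntegrableOn (fun t : ℝ => C * t ^ (q - 1 - α)) (Set.Ioi R) :=
      (integrableOn_Ioi_rpow_of_lt (by linarith) hR0).const_mul C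
    refine lt_of_le_of_lt (setLIntegral_mono_ae' measurableSet_Ioi
      (g := fun t => ENNReal.ofReal (C * t ^ (q - 1 - α))) ?_) hint.lintegral_lt_top
    refine Eventually.of_forall fun t ht => ?_
    have ht0 : 0 < t := hR0.trans ht
    rw [← ofReal_measureReal, ← ENNReal.ofReal_mul measureReal_nonneg]
    refine ENNReal.ofReal_le_ofReal ?_
    refine (mul_le_mul_of_nonneg_right (hR t (le_of_lt ht))
      (Real.rpow_nonneg ht0.le _)).trans_eq ?_
    rw [mul_assoc, ← Real.rpow_add ht0]
    ring_nf

/-- A real variable whose lower and upper tails agree has the law of its negative. -/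
lemma identDistrib_neg_of_tails {Z : Ω → ℝ} (hZ : Measurable Z)
    (hS : ∀ x : ℝ, 0 ≤ x → P.real {ω | Z ω ≤ -x} = P.real {ω | x ≤ Z ω}) :
    IdentDistrib Z (fun ω => -Z ω) P P := by
  refine ⟨hZ.aemeasurable, hZ.neg.aemeasurable, ?_⟩
  have hS' : ∀ x : ℝ, 0 ≤ x → P {ω | Z ω ≤ -x} = P {ω | x ≤ Z ω} := fun x hx =>
    (measureReal_eq_measureReal_iff).1 (hS x hx)
  have hpos : ∀ x : ℝ, 0 ≤ x → P {ω | x < Z ω} = P {ω | Z ω < -x} := by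
    intro x hx
    obtain ⟨u, hu, hux, hulim⟩ := exists_seq_strictAnti_tendsto x
    have e1 : {ω | x < Z ω} = ⋃ n, {ω | u n ≤ Z ω} := by
      ext ω
      simp only [Set.mem_iUnion, Set.mem_ofPred_eq]
      constructor
      · intro h
        obtain ⟨n, hn⟩ := (hulim.eventually_lt_const h).exists
        exact ⟨n, hn.le⟩
      · rintro ⟨n, hn⟩
        exact (hux n).trans_le hn
    have e2 : {ω | Z ω < -x} = ⋃ n, {ω | Z ω ≤ -u n} := by
      ext ω
      simp only [Set.mem_iUnion, Set.mem_ofPred_eq]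
      constructor
      · intro h
        obtain ⟨n, hn⟩ := (hulim.eventually_lt_const (show x < -Z ω by linarith)).exists
        exact ⟨n, by linarith⟩
      · rintro ⟨n, hn⟩
        linarith [hux n]
    rw [e1, e2, Monotone.measure_iUnion, Monotone.measure_iUnion]
    · exact iSup_congr fun n => (hS' _ (hx.trans (hux n).le)).symm
    · intro m n hmn ω hω
      have : u n ≤ u m := hu.antitone hmn
      simp only [Set.mem_ofPred_eq] at hω ⊢
      linarith
    · intro m n hmn ω hω
      have : u n ≤ u m := hu.antitone hmn
      simp only [Set.mem_ofPred_eq] at hω ⊢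
      linarith
  have := Measure.isProbabilityMeasure_map (μ := P) hZ.aemeasurable
  have := Measure.isProbabilityMeasure_map (μ := P) (f := fun ω => -Z ω) hZ.neg.aemeasurable
  refine Measure.ext_of_Iic _ _ fun x => ?_
  rw [Measure.map_apply hZ measurableSet_Iic, Measure.map_apply (f := fun ω => -Z ω) hZ.neg
      measurableSet_Iic]
  change P {ω | Z ω ≤ x} = P {ω | -Z ω ≤ x}
  rcases le_total x 0 with hx | hx
  · have h := hS' (-x) (by linarith)
    rw [neg_neg] at h
    rw [h]
    congr 1
    ext ω
    exact neg_le (α := ℝ)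
  · have e1 : {ω | Z ω ≤ x} = {ω | x < Z ω}ᶜ := by ext ω; simp
    have e2 : {ω | -Z ω ≤ x} = {ω | Z ω < -x}ᶜ := by ext ω; simp [neg_le]
    rw [e1, e2, prob_compl_eq_one_sub (measurableSet_lt measurable_const hZ),
      prob_compl_eq_one_sub (measurableSet_lt hZ measurable_const), hpos x hx]

end

/-! ### The zero-one law for summability -/

lemma measurableSet_setOf_summable_of_nonneg {Ω : Type*} {mΩ : MeasurableSpace Ω} {f : ℕ → Ω → ℝ}
    (hf : ∀ n, Measurable (f n)) (h0 : ∀ n ω, 0 ≤ f n ω) :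
    MeasurableSet {ω | Summable fun n => f n ω} := by
  have : {ω | Summable fun n => f n ω} = {ω | ∑' n, ENNReal.ofReal (f n ω) ≠ ⊤} := by
    ext ω
    simp only [Set.mem_ofPred_eq]
    refine ⟨fun h => h.tsum_ofReal_ne_top, fun h => ?_⟩
    have := ENNReal.summable_toReal h
    simpa only [ENNReal.toReal_ofReal (h0 _ ω)] using this
  rw [this]
  exact (measurableSet_singleton _).compl.preimage
    (Measurable.tsum fun n => (hf n).ennreal_ofReal)

lemma summable_exp_sum_range_iff (w : ℕ → ℝ) (N : ℕ) :
    (Summable fun n => Real.exp (∑ k ∈ Finset.range n, w k)) ↔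
      Summable fun n => Real.exp (∑ k ∈ Finset.range n, w (k + N)) := by
  rw [← summable_nat_add_iff N]
  have : ∀ n, Real.exp (∑ k ∈ Finset.range (n + N), w k) =
      Real.exp (∑ k ∈ Finset.range N, w k) * Real.exp (∑ k ∈ Finset.range n, w (k + N)) := by
    intro n
    rw [← Real.exp_add, add_comm n N, Finset.sum_range_add]
    simp only [add_comm]
  simp only [this]
  exact summable_mul_left_iff (Real.exp_pos _).ne'

/-- Summability of the exponentials of a random walk with independent steps is a tail event. -/
lemma measure_summable_exp_sum_zero_or_one {Ω : Type*} [MeasurableSpace Ω] {P : Measure Ω}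
    {E : Type*} [MeasurableSpace E] {X : ℕ → Ω → E}
    (hX : ∀ n, Measurable (X n)) (hind : iIndepFun X P) {w : E → ℝ} (hw : Measurable w) :
    P {ω | Summable fun n => Real.exp (∑ k ∈ Finset.range n, w (X k ω))} = 0 ∨
      P {ω | Summable fun n => Real.exp (∑ k ∈ Finset.range n, w (X k ω))} = 1 := by
  refine measure_zero_or_one_of_measurableSet_limsup_atTop
    (s := fun n => MeasurableSpace.comap (X n) inferInstance) (fun n => (hX n).comap_le) hind ?_
  rw [limsup_eq_iInf_iSup_of_nat, MeasurableSpace.measurableSet_iInf]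
  intro N
  have hN : {ω | Summable fun n => Real.exp (∑ k ∈ Finset.range n, w (X k ω))} =
      {ω | Summable fun n => Real.exp (∑ k ∈ Finset.range n, w (X (k + N) ω))} := by
    ext ω
    exact summable_exp_sum_range_iff (fun k => w (X k ω)) N
  rw [hN]
  refine @measurableSet_setOf_summable_of_nonneg Ω
    (⨆ i ≥ N, MeasurableSpace.comap (X i) inferInstance)
    (fun n ω => Real.exp (∑ k ∈ Finset.range n, w (X (k + N) ω))) (fun n => ?_)
    fun n ω => (Real.exp_pos _).le
  refine Real.measurable_exp.comp (Finset.measurable_fun_sum _ fun k _ => hw.comp ?_)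
  exact (comap_measurable (X (k + N))).mono
    (le_iSup₂_of_le (f := fun i (_ : i ≥ N) => MeasurableSpace.comap (X i) inferInstance)
      (k + N) (Nat.le_add_left N k) le_rfl) le_rfl

section

variable {Ω : Type*} [MeasurableSpace Ω] {P : Measure Ω} [IsProbabilityMeasure P]

/-! ### Symmetric steps dominated by the drift -/

/-- Pointwise second-order bound for the exponential of a step, which is `t` where `a = 0` and the
drift `-l` where `a = 1`. -/
lemma exp_le_one_add_of_indicator {a t θ l : ℝ} (ha : a = 0 ∨ a = 1) (hat : a * t = 0)
    (hθ : 0 ≤ θ) (hl : 0 ≤ l) (hθl : θ * l ≤ 1 / 4) (hθt : |θ * t| ≤ 1) :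
    Real.exp (θ * (t - l * a)) ≤ 1 + θ * t + θ ^ 2 * t ^ 2 - 3 / 4 * (θ * l) * a := by
  have h0 : 0 ≤ θ * l := mul_nonneg hθ hl
  rcases ha with rfl | rfl
  · have := abs_le.1 (Real.abs_exp_sub_one_sub_id_le hθt)
    simp only [mul_zero, sub_zero]
    nlinarith [this.2]
  · obtain rfl : t = 0 := by simpa using hat
    have hle : |-(θ * l)| ≤ 1 := by rw [abs_neg, abs_of_nonneg h0]; linarith
    have := abs_le.1 (Real.abs_exp_sub_one_sub_id_le hle)
    have e : θ * (0 - l * 1) = -(θ * l) := by ring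
    rw [e]
    nlinarith [this.2]

/-- A sum of independent symmetric variables with a moment of order `q > 1 / (1 - β)` is dominated
by a drift `-l` acting at site `k` with probability `(k + 1) ^ (-β)`: after truncation at level
`(k + 1) ^ (1 / q)`, Chernoff's bound with parameter `n ^ (-1 / q)` makes the probability of a
failure at time `n` at most a constant times `exp (-(l / 4) * n ^ (1 - β - 1 / q))`, which is
summable. -/
theorem ae_eventually_sum_le_of_drift {a U V : ℕ → Ω → ℝ} {l β q : ℝ}
    (hl : 0 < l) (hβ0 : 0 < β) (hβ : β < 1) (hq1 : 1 / (1 - β) < q) (hq2 : q < 2)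
    (ham : ∀ n, Measurable (a n)) (hUm : ∀ n, Measurable (U n))
    (hind : iIndepFun (fun n ω => (a n ω, U n ω)) P)
    (ha : ∀ n ω, a n ω = 0 ∨ a n ω = 1) (haU : ∀ n ω, a n ω * U n ω = 0)
    (ha_mean : ∀ n : ℕ, ∫ ω, a n ω ∂P = ((n : ℝ) + 1) ^ (-β))
    (hU : ∀ n, IdentDistrib (U n) (fun ω => -U n ω) P P)
    (hUV : ∀ n ω, |U n ω| ≤ |V n ω|) (hV : ∀ n, IdentDistrib (V n) (V 0) P P)
    (hVq : Integrable (fun ω => |V 0 ω| ^ q) P) :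
    ∀ᵐ ω ∂P, ∀ᶠ n : ℕ in atTop,
      ∑ k ∈ Finset.range n, (U k ω - l * a k ω) ≤ -(l / 4) * (n : ℝ) ^ (1 - β) := by
  have hγ : 0 < 1 - β := by linarith
  have hq0 : 0 < q := (by positivity : (0 : ℝ) < 1 / (1 - β)).trans hq1
  set τ : ℝ := 1 / q with hτ
  have hτ0 : 0 < τ := by positivity
  have hτγ : τ < 1 - β := by rw [hτ, div_lt_iff₀ hq0]; rwa [div_lt_iff₀ hγ, mul_comm] at hq1
  have hτq : τ * q = 1 := by rw [hτ]; field_simp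
  -- The level `(k + 1) ^ τ` with `τ q = 1` is high enough for a moment of order `q` to allow only
  -- finitely many exceedances, and low enough, as `τ < 1 - β`, for Chernoff's bound below.
  set g : ℕ → ℝ → ℝ := fun k u => if |u| ≤ ((k : ℝ) + 1) ^ τ then u else 0 with hg
  have hgm : ∀ k, Measurable (g k) := fun k =>
    Measurable.ite (measurableSet_le measurable_id.abs measurable_const) measurable_id
      measurable_const
  have hgodd : ∀ k u, g k (-u) = -g k u := by
    intro k u; simp only [hg, abs_neg]; split_ifs <;> simp
  have hgle : ∀ k u, |g k u| ≤ ((k : ℝ) + 1) ^ τ := by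
    intro k u; simp only [hg]; split_ifs with h
    · exact h
    · simp; positivity
  have hgle' : ∀ k u, |g k u| ≤ |u| := by
    intro k u; simp only [hg]; split_ifs <;> simp
  have hVint : ∀ k, Integrable (fun ω => |V k ω| ^ q) P ∧
      ∫ ω, |V k ω| ^ q ∂P = ∫ ω, |V 0 ω| ^ q ∂P := by
    intro k
    have := (hV k).comp (u := fun x : ℝ => |x| ^ q) (by fun_prop)
    exact ⟨this.integrable_iff.2 hVq, this.integral_eq⟩
  set m : ℝ := ∫ ω, |V 0 ω| ^ q ∂P with hm
  set T : ℕ → Ω → ℝ := fun k ω => g k (U k ω) with hT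
  have hTm : ∀ k, Measurable (T k) := fun k => (hgm k).comp (hUm k)
  have hTint : ∀ k, Integrable (T k) P := fun k =>
    Integrable.of_bound (hTm k).aestronglyMeasurable (((k : ℝ) + 1) ^ τ)
      (Eventually.of_forall fun ω => hgle k _)
  have hTint2 : ∀ k, Integrable (fun ω => T k ω ^ 2) P := fun k =>
    Integrable.of_bound ((hTm k).pow_const 2).aestronglyMeasurable ((((k : ℝ) + 1) ^ τ) ^ 2)
      (Eventually.of_forall fun ω => by
        rw [Real.norm_eq_abs, abs_pow]; gcongr; exact hgle k _)
  have haint : ∀ k, Integrable (a k) P := fun k =>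
    Integrable.of_bound (ham k).aestronglyMeasurable 1
      (Eventually.of_forall fun ω => by rcases ha k ω with h | h <;> simp [h])
  have hTmean : ∀ k, ∫ ω, T k ω ∂P = 0 := by
    intro k
    have h := ((hU k).comp (hgm k)).integral_eq
    simp only [Function.comp_def, hgodd, integral_neg] at h
    simp only [hT]
    linarith
  have hTsq : ∀ n k : ℕ, k < n → ∫ ω, T k ω ^ 2 ∂P ≤ m * (n : ℝ) ^ (2 * τ - 1) := by
    intro n k hk
    rw [← (hVint k).2, ← integral_mul_const]
    refine integral_mono (hTint2 k) ((hVint k).1.mul_const _) fun ω => ?_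
    have h1 : |T k ω| ≤ (n : ℝ) ^ τ := (hgle k _).trans
      (Real.rpow_le_rpow (by positivity) (by exact_mod_cast hk) hτ0.le)
    have h2 : |T k ω| ≤ |V k ω| := (hgle' k _).trans (hUV k ω)
    have h3 : T k ω ^ 2 = |T k ω| ^ q * |T k ω| ^ (2 - q) := by
      rw [← Real.rpow_add' (abs_nonneg _) (by norm_num)]
      norm_num
    have h4 : (n : ℝ) ^ (2 * τ - 1) = ((n : ℝ) ^ τ) ^ (2 - q) := by
      rw [← Real.rpow_mul (Nat.cast_nonneg n)]
      congr 1
      linear_combination hτq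
    simp only
    rw [h3, h4]
    gcongr
  set Y : ℕ → Ω → ℝ := fun k ω => T k ω - l * a k ω with hY
  have hYm : ∀ k, Measurable (Y k) := fun k => (hTm k).sub ((ham k).const_mul l)
  have hYind : iIndepFun Y P := by
    refine hind.comp (fun k (x : ℝ × ℝ) => g k x.2 - l * x.1) fun k => ?_
    exact ((hgm k).comp measurable_snd).sub (measurable_fst.const_mul l)
  -- The parameter `n ^ (-τ)` keeps the exponents bounded; the second moments then cost a factor
  -- `exp (m / n)` per step, so a bounded factor in total.
  have hmgf : ∀ n k : ℕ, k < n → (n : ℝ) ^ (-τ) * l ≤ 1 / 4 →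
      Integrable (fun ω => Real.exp ((n : ℝ) ^ (-τ) * Y k ω)) P ∧
      mgf (Y k) P ((n : ℝ) ^ (-τ)) ≤
        Real.exp (m / n - 3 / 4 * ((n : ℝ) ^ (-τ) * l) * ((k : ℝ) + 1) ^ (-β)) := by
    intro n k hk hn
    have hn0 : (0 : ℝ) < n := by exact_mod_cast (Nat.zero_le k).trans_lt hk
    set θ : ℝ := (n : ℝ) ^ (-τ) with hθ
    have hθ0 : 0 ≤ θ := Real.rpow_nonneg hn0.le _
    have hpt : ∀ ω, Real.exp (θ * Y k ω) ≤
        1 + θ * T k ω + θ ^ 2 * T k ω ^ 2 - 3 / 4 * (θ * l) * a k ω := by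
      intro ω
      refine exp_le_one_add_of_indicator (ha k ω) ?_ hθ0 hl.le hn ?_
      · rcases ha k ω with h | h
        · simp [h]
        · have h0 : U k ω = 0 := by simpa [h] using haU k ω
          simp only [hT, h0, hg]
          split_ifs <;> simp
      · rw [abs_mul, abs_of_nonneg hθ0]
        have h1 : |T k ω| ≤ (n : ℝ) ^ τ := (hgle k _).trans
          (Real.rpow_le_rpow (by positivity) (by exact_mod_cast hk) hτ0.le)
        calc θ * |T k ω| ≤ θ * (n : ℝ) ^ τ := by gcongr
          _ = 1 := by rw [hθ, ← Real.rpow_add hn0]; simp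
    have hint1 : Integrable (fun ω => 1 + θ * T k ω) P :=
      (integrable_const 1).add ((hTint k).const_mul θ)
    have hint2 : Integrable (fun ω => 1 + θ * T k ω + θ ^ 2 * T k ω ^ 2) P :=
      hint1.add ((hTint2 k).const_mul _)
    have hint : Integrable (fun ω =>
        1 + θ * T k ω + θ ^ 2 * T k ω ^ 2 - 3 / 4 * (θ * l) * a k ω) P :=
      hint2.sub ((haint k).const_mul _)
    have hexp : Integrable (fun ω => Real.exp (θ * Y k ω)) P :=
      hint.mono' ((hYm k).const_mul θ).exp.aestronglyMeasurable
        (Eventually.of_forall fun ω => by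
          rw [Real.norm_eq_abs, abs_of_pos (Real.exp_pos _)]; exact hpt ω)
    refine ⟨hexp, ?_⟩
    have hle := integral_mono hexp hint hpt
    rw [integral_sub hint2 ((haint k).const_mul _),
      integral_add hint1 ((hTint2 k).const_mul _),
      integral_add (integrable_const 1) ((hTint k).const_mul θ), integral_const_mul,
      integral_const_mul, integral_const_mul, hTmean, ha_mean] at hle
    simp only [integral_const, probReal_univ, smul_eq_mul, mul_one, mul_zero, add_zero] at hle
    have hsq : θ ^ 2 * ∫ ω, T k ω ^ 2 ∂P ≤ m / n := by
      calc θ ^ 2 * ∫ ω, T k ω ^ 2 ∂P ≤ θ ^ 2 * (m * (n : ℝ) ^ (2 * τ - 1)) := by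
            gcongr; exact hTsq n k hk
        _ = m * ((n : ℝ) ^ (-τ + -τ + (2 * τ - 1))) := by
            rw [Real.rpow_add hn0, Real.rpow_add hn0, ← hθ]; ring
        _ = m / n := by
            rw [show -τ + -τ + (2 * τ - 1) = -1 by ring, Real.rpow_neg_one]; rfl
    rw [mgf]
    refine (hle.trans ?_).trans (Real.add_one_le_exp _)
    linarith
  have hprob : ∀ n : ℕ, 0 < n → (n : ℝ) ^ (-τ) * l ≤ 1 / 4 →
      P.real {ω | -(l / 2) * (n : ℝ) ^ (1 - β) ≤ (∑ k ∈ Finset.range n, Y k) ω} ≤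
        Real.exp m * Real.exp (-(l / 4) * (n : ℝ) ^ (1 - β - τ)) := by
    intro n hn hnl
    have hn0 : (0 : ℝ) < n := by exact_mod_cast hn
    have hθ0 : 0 ≤ (n : ℝ) ^ (-τ) := Real.rpow_nonneg hn0.le _
    refine (measure_ge_le_exp_mul_mgf _ hθ0 ?_).trans ?_
    · exact hYind.integrable_exp_mul_sum hYm fun k hk => (hmgf n k (Finset.mem_range.1 hk) hnl).1
    · rw [hYind.mgf_sum hYm]
      have h1 : ∏ k ∈ Finset.range n, mgf (Y k) P ((n : ℝ) ^ (-τ)) ≤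
          Real.exp (m - 3 / 4 * ((n : ℝ) ^ (-τ) * l) * (n : ℝ) ^ (1 - β)) := by
        refine (Finset.prod_le_prod (fun k _ => mgf_nonneg)
          fun k hk => (hmgf n k (Finset.mem_range.1 hk) hnl).2).trans ?_
        rw [← Real.exp_sum, Finset.sum_sub_distrib, ← Finset.mul_sum]
        have h2 : (n : ℝ) ^ (1 - β) ≤ ∑ k ∈ Finset.range n, ((k : ℝ) + 1) ^ (-β) := by
          calc (n : ℝ) ^ (1 - β) = ∑ k ∈ Finset.range n, (n : ℝ) ^ (-β) := by
                rw [Finset.sum_const, Finset.card_range, nsmul_eq_mul, sub_eq_add_neg,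
                  Real.rpow_add hn0, Real.rpow_one]
            _ ≤ _ := Finset.sum_le_sum fun k hk =>
                Real.rpow_le_rpow_of_nonpos (by positivity)
                  (by exact_mod_cast Finset.mem_range.1 hk) (by linarith)
        have h3 : ∑ _k ∈ Finset.range n, m / n = m := by
          rw [Finset.sum_const, Finset.card_range, nsmul_eq_mul]; field_simp
        rw [h3]
        gcongr
      refine (mul_le_mul_of_nonneg_left h1 (Real.exp_pos _).le).trans_eq ?_
      rw [← Real.exp_add, ← Real.exp_add]
      congr 1
      rw [show 1 - β - τ = -τ + (1 - β) by ring, Real.rpow_add hn0]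
      ring
  have hlim : Tendsto (fun n : ℕ => (n : ℝ) ^ (1 - β)) atTop atTop :=
    (tendsto_rpow_atTop hγ).comp tendsto_natCast_atTop_atTop
  have hsmall : ∀ᶠ n : ℕ in atTop, 0 < n ∧ (n : ℝ) ^ (-τ) * l ≤ 1 / 4 := by
    have h1 : Tendsto (fun n : ℕ => (n : ℝ) ^ (-τ) * l) atTop (nhds (0 * l)) :=
      ((tendsto_rpow_neg_atTop hτ0).comp tendsto_natCast_atTop_atTop).mul_const l
    rw [zero_mul] at h1
    exact (eventually_gt_atTop 0).and (h1.eventually_le_const (by norm_num))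
  have hBC1 : ∀ᵐ ω ∂P, ∀ᶠ n : ℕ in atTop,
      ¬ -(l / 2) * (n : ℝ) ^ (1 - β) ≤ (∑ k ∈ Finset.range n, Y k) ω := by
    refine ae_eventually_notMem (s := fun n : ℕ =>
      {ω | -(l / 2) * (n : ℝ) ^ (1 - β) ≤ (∑ k ∈ Finset.range n, Y k) ω}) ?_
    have hsum : Summable fun n : ℕ =>
        P.real {ω | -(l / 2) * (n : ℝ) ^ (1 - β) ≤ (∑ k ∈ Finset.range n, Y k) ω} := by
      refine ((summable_exp_neg_mul_rpow (b := l / 4) (s := 1 - β - τ) (by positivity)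
        (by linarith)).mul_left (Real.exp m)).of_norm_bounded_eventually_nat ?_
      filter_upwards [hsmall] with n hn
      rw [Real.norm_eq_abs, abs_of_nonneg measureReal_nonneg]
      exact hprob n hn.1 hn.2
    have := hsum.tsum_ofReal_ne_top
    simpa only [ofReal_measureReal (measure_ne_top P _)] using this
  have hBC2 : ∀ᵐ ω ∂P, ∀ᶠ n : ℕ in atTop, T n ω = U n ω := by
    have h := ae_eventually_notMem (μ := P)
      (s := fun n : ℕ => {ω | |V n ω| ^ q ∈ Set.Ioi ((n : ℝ))}) ?_
    · filter_upwards [h] with ω hω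
      filter_upwards [hω] with n hn
      simp only [Set.mem_Ioi, not_lt] at hn
      simp only [hT, hg]
      rw [if_pos]
      calc |U n ω| ≤ |V n ω| := hUV n ω
        _ = (|V n ω| ^ q) ^ τ := by
          rw [← Real.rpow_mul (abs_nonneg _), mul_comm, hτq, Real.rpow_one]
        _ ≤ ((n : ℝ) + 1) ^ τ := by
          gcongr
          linarith
    · have h1 := @tsum_prob_mem_Ioi_lt_top Ω ⟨P⟩ ‹_› _ hVq fun ω =>
        Real.rpow_nonneg (abs_nonneg _) q
      convert h1.ne using 3 with n
      have := (hV n).comp (u := fun x : ℝ => |x| ^ q) (by fun_prop)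
      exact this.measure_mem_eq measurableSet_Ioi
  filter_upwards [hBC1, hBC2] with ω h1 h2
  -- The finitely many truncated terms change the sum by a constant, absorbed by half of the drift.
  obtain ⟨N, hN⟩ := eventually_atTop.1 h2
  set D : ℝ := ∑ k ∈ Finset.range N, (U k ω - T k ω) with hD
  filter_upwards [h1, eventually_ge_atTop N,
    hlim.eventually_ge_atTop (D / (l / 4))] with n hn hNn hDn
  rw [div_le_iff₀ (by positivity)] at hDn
  have hsplit : ∑ k ∈ Finset.range n, (U k ω - l * a k ω) =
      (∑ k ∈ Finset.range n, Y k) ω + D := by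
    have : ∑ k ∈ Finset.range n, (U k ω - T k ω) = D := by
      rw [hD]
      refine (Finset.sum_subset (Finset.range_mono hNn) fun k _ hk => ?_).symm
      rw [hN k (by simpa using hk), sub_self]
    rw [← this, Finset.sum_apply, ← Finset.sum_add_distrib]
    refine Finset.sum_congr rfl fun k _ => ?_
    simp only [hY]; ring
  rw [hsplit]
  nlinarith

/-! ### Jumps beating the drift -/

/-- Along an environment whose fast points have mean density `k ^ (-β)`, the number of fast points
before `n` is at most a random multiple of `n ^ η`, for each `η > 1 - β`. -/
lemma ae_exists_sum_indicator_le {a : ℕ → Ω → ℝ} {β η : ℝ} (hη0 : 0 < η) (hη : 1 - β < η)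
    (ham : ∀ n, Measurable (a n)) (ha : ∀ n ω, a n ω = 0 ∨ a n ω = 1)
    (ha_mean : ∀ n : ℕ, ∫ ω, a n ω ∂P = ((n : ℝ) + 1) ^ (-β)) :
    ∀ᵐ ω ∂P, ∃ M : ℝ, 0 ≤ M ∧ ∀ n : ℕ, ∑ k ∈ Finset.range n, a k ω ≤ M * (n : ℝ) ^ η := by
  have ha0 : ∀ n ω, 0 ≤ a n ω := fun n ω => by rcases ha n ω with h | h <;> simp [h]
  have hint : ∀ k, Integrable (a k) P := fun k =>
    Integrable.of_bound (ham k).aestronglyMeasurable 1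
      (Eventually.of_forall fun ω => by rcases ha k ω with h | h <;> simp [h])
  have hm : ∀ k : ℕ, Measurable fun ω => ENNReal.ofReal (a k ω * ((k : ℝ) + 1) ^ (-η)) :=
    fun k => ((ham k).mul_const _).ennreal_ofReal
  have hfin : ∫⁻ ω, ∑' k : ℕ, ENNReal.ofReal (a k ω * ((k : ℝ) + 1) ^ (-η)) ∂P ≠ ⊤ := by
    rw [lintegral_tsum fun k => (hm k).aemeasurable]
    have h1 : ∀ k : ℕ, ∫⁻ ω, ENNReal.ofReal (a k ω * ((k : ℝ) + 1) ^ (-η)) ∂P =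
        ENNReal.ofReal (((k + 1 : ℕ) : ℝ) ^ (-β - η)) := by
      intro k
      rw [← ofReal_integral_eq_lintegral_ofReal ((hint k).mul_const _)
        (Eventually.of_forall fun ω => mul_nonneg (ha0 k ω) (by positivity)),
        integral_mul_const, ha_mean, ← Real.rpow_add (by positivity)]
      push_cast
      ring_nf
    simp only [h1]
    refine Summable.tsum_ofReal_ne_top ?_
    rw [summable_nat_add_iff 1 (f := fun n : ℕ => (n : ℝ) ^ (-β - η))]
    exact Real.summable_nat_rpow.2 (by linarith)
  filter_upwards [ae_lt_top (Measurable.tsum hm) hfin] with ω hω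
  have hsum : Summable fun k : ℕ => a k ω * ((k : ℝ) + 1) ^ (-η) := by
    have := ENNReal.summable_toReal hω.ne
    refine this.congr fun k => ENNReal.toReal_ofReal (mul_nonneg (ha0 k ω) (by positivity))
  refine ⟨∑' k : ℕ, a k ω * ((k : ℝ) + 1) ^ (-η),
    tsum_nonneg fun k => mul_nonneg (ha0 k ω) (by positivity), fun n => ?_⟩
  refine le_trans ?_ (mul_le_mul_of_nonneg_right (hsum.sum_le_tsum (Finset.range n)
    fun k _ => mul_nonneg (ha0 k ω) (by positivity)) (by positivity))
  rw [Finset.sum_mul]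
  refine Finset.sum_le_sum fun k hk => ?_
  have hk' : ((k : ℝ) + 1) ≤ n := by exact_mod_cast Finset.mem_range.1 hk
  rw [mul_assoc]
  refine le_mul_of_one_le_right (ha0 k ω) ?_
  calc (1 : ℝ) = ((k : ℝ) + 1) ^ (-η) * ((k : ℝ) + 1) ^ η := by
        rw [← Real.rpow_add (by positivity)]; simp
    _ ≤ _ := by gcongr

/-- A symmetric random walk with jumps exceeding `n ^ η` infinitely often cannot be carried to
`-∞` by a drift at fast points of mean density `k ^ (-β)` with `1 - β < η`.

By the zero-one law the exponentials of the walk would otherwise be summable almost surely, and by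
symmetry so would those of the walk with reflected symmetric part. Both walks being negative, the
symmetric part, and hence each of its steps, would be bounded by a multiple of the number of fast
points, contrary to the size of the jumps. -/
theorem ae_not_summable_exp_of_jumps {a U : ℕ → Ω → ℝ} {l β η : ℝ}
    (hβ : β < 1) (hη : 1 - β < η)
    (ham : ∀ n, Measurable (a n)) (hUm : ∀ n, Measurable (U n))
    (hind : iIndepFun (fun n ω => (a n ω, U n ω)) P)
    (ha : ∀ n ω, a n ω = 0 ∨ a n ω = 1)
    (ha_mean : ∀ n : ℕ, ∫ ω, a n ω ∂P = ((n : ℝ) + 1) ^ (-β))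
    (hflip : ∀ n, IdentDistrib (fun ω => (a n ω, U n ω)) (fun ω => (a n ω, -U n ω)) P P)
    (hjump : ¬ Summable fun n : ℕ => P.real {ω | ((n : ℝ) + 1) ^ η < |U n ω|}) :
    ∀ᵐ ω ∂P, ¬ Summable fun n =>
      Real.exp (∑ k ∈ Finset.range n, (U k ω - l * a k ω)) := by
  have hpm : ∀ n, Measurable fun ω => (a n ω, U n ω) := fun n => (ham n).prodMk (hUm n)
  have hw : Measurable fun x : ℝ × ℝ => x.2 - l * x.1 := by fun_prop
  have h01 := measure_summable_exp_sum_zero_or_one hpm hind hw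
  rcases h01 with h0 | h1
  · exact measure_eq_zero_iff_ae_notMem.1 h0
  exfalso
  have hE : MeasurableSet {x : ℕ → ℝ × ℝ | Summable fun n =>
      Real.exp (∑ k ∈ Finset.range n, ((x k).2 - l * (x k).1))} :=
    measurableSet_setOf_summable_of_nonneg (fun n => by fun_prop) fun n x => (Real.exp_pos _).le
  have hs1 : ∀ᵐ ω ∂P, Summable fun n =>
      Real.exp (∑ k ∈ Finset.range n, (U k ω - l * a k ω)) :=
    (mem_ae_iff_prob_eq_one (hE.preimage (measurable_pi_lambda _ hpm))).2 h1
  have hs2 : ∀ᵐ ω ∂P, Summable fun n =>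
      Real.exp (∑ k ∈ Finset.range n, (-U k ω - l * a k ω)) := by
    have hind' : iIndepFun (fun n ω => (a n ω, -U n ω)) P :=
      hind.comp (fun _ (x : ℝ × ℝ) => (x.1, -x.2)) fun _ => by fun_prop
    exact (IdentDistrib.pi hflip hind hind').ae_snd hE hs1
  have hbc : ∀ᵐ ω ∂P, ∃ᶠ n : ℕ in atTop, ((n : ℝ) + 1) ^ η < |U n ω| := by
    set s : ℕ → Set Ω := fun n => {ω | ((n : ℝ) + 1) ^ η < |U n ω|} with hs
    have hsm : ∀ n, MeasurableSet (s n) := fun n => measurableSet_lt measurable_const (hUm n).abs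
    have hsi : iIndepSet s P := by
      rw [iIndepSet_iff_meas_biInter hsm]
      intro S
      exact hind.measure_inter_preimage_eq_mul S
        (sets := fun n => {x : ℝ × ℝ | ((n : ℝ) + 1) ^ η < |x.2|})
        fun n _ => measurableSet_lt measurable_const measurable_snd.abs
    have hone := measure_limsup_eq_one hsm hsi (by
      by_contra h
      exact hjump (ENNReal.summable_toReal h))
    have := (mem_ae_iff_prob_eq_one (MeasurableSet.measurableSet_limsup hsm)).2 hone
    filter_upwards [this] with ω hω
    exact mem_limsup_iff_frequently_mem.1 hω
  obtain ⟨η', h1η', hη'⟩ := exists_between hη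
  have hη'0 : 0 < η' := by linarith
  have hcount := ae_exists_sum_indicator_le (P := P) hη'0 h1η' ham ha ha_mean
  have hfalse : ∀ᵐ _ω ∂P, False := by
    filter_upwards [hs1, hs2, hbc, hcount] with ω hω1 hω2 hω3 ⟨M, hM0, hM⟩
    have hneg : ∀ w : ℕ → ℝ, (Summable fun n => Real.exp (∑ k ∈ Finset.range n, w k)) →
        ∀ᶠ n : ℕ in atTop, ∑ k ∈ Finset.range n, w k < 0 := by
      intro w hw
      filter_upwards [hw.tendsto_atTop_zero.eventually_lt_const one_pos] with n hn
      exact Real.exp_lt_one_iff.1 hn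
    have hW : ∀ᶠ n : ℕ in atTop,
        |∑ k ∈ Finset.range n, U k ω| ≤ |l| * (M * (n : ℝ) ^ η') := by
      filter_upwards [hneg _ hω1, hneg _ hω2] with n hn1 hn2
      rw [Finset.sum_sub_distrib, ← Finset.mul_sum] at hn1 hn2
      rw [Finset.sum_neg_distrib] at hn2
      have hN0 : 0 ≤ ∑ k ∈ Finset.range n, a k ω :=
        Finset.sum_nonneg fun k _ => by rcases ha k ω with h | h <;> simp [h]
      have h3 : l * ∑ k ∈ Finset.range n, a k ω ≤ |l| * (M * (n : ℝ) ^ η') :=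
        (mul_le_mul_of_nonneg_right (le_abs_self l) hN0).trans
          (mul_le_mul_of_nonneg_left (hM n) (abs_nonneg l))
      exact abs_le.2 ⟨by linarith, by linarith⟩
    have hlim : Tendsto (fun n : ℕ => ((n : ℝ) + 1) ^ (η - η')) atTop atTop :=
      (tendsto_rpow_atTop (by linarith)).comp
        (tendsto_atTop_add_const_right _ _ tendsto_natCast_atTop_atTop)
    obtain ⟨n, hn, hn1, hn2, hn3⟩ := (hω3.and_eventually (hW.and
      (((tendsto_add_atTop_nat 1).eventually hW).and
        (hlim.eventually_ge_atTop (2 * (|l| * M)))))).exists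
    have hb : (0 : ℝ) < (n : ℝ) + 1 := by positivity
    have h5 : ((n : ℝ) + 1) ^ η = ((n : ℝ) + 1) ^ (η - η') * ((n : ℝ) + 1) ^ η' := by
      rw [← Real.rpow_add hb]; ring_nf
    have h6 : (n : ℝ) ^ η' ≤ ((n : ℝ) + 1) ^ η' := by gcongr; linarith
    have h7 : U n ω = ∑ k ∈ Finset.range (n + 1), U k ω - ∑ k ∈ Finset.range n, U k ω := by
      rw [Finset.sum_range_succ]; ring
    push_cast at hn2
    have h8 : |U n ω| ≤ 2 * (|l| * M) * ((n : ℝ) + 1) ^ η' := by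
      rw [h7]
      refine (abs_sub _ _).trans ?_
      have : |l| * (M * (n : ℝ) ^ η') ≤ |l| * (M * ((n : ℝ) + 1) ^ η') := by gcongr
      linarith
    have h9 : 2 * (|l| * M) * ((n : ℝ) + 1) ^ η' ≤ ((n : ℝ) + 1) ^ η := by
      rw [h5]; gcongr
    linarith
  exact hfalse.exists.elim fun _ h => h

end

/-! ### The random environment -/

lemma measurable_logOdds : Measurable logOdds := by
  unfold logOdds
  exact (measurable_subtype_coe.div (measurable_const.sub measurable_subtype_coe)).log

/-- The log-odds at a site is `ζ` at a slow point and the constant `log ((1 - δ) / (1 + δ))` at a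
fast point. -/
lemma logOdds_siteProb (δ : Set.Ioo (-1 : ℝ) 1) (χ : ({0, 1} : Set ℝ)) (ξ : Set.Ioo (0 : ℝ) 1) :
    logOdds (siteProb δ χ ξ) =
      (1 - (χ : ℝ)) * logOdds ξ - Real.log ((1 + (δ : ℝ)) / (1 - (δ : ℝ))) * (χ : ℝ) := by
  obtain ⟨k, hk⟩ := χ
  have h1 : 0 < 1 + (δ : ℝ) := by linarith [δ.2.1]
  have h2 : 0 < 1 - (δ : ℝ) := by linarith [δ.2.2]
  rcases hk with rfl | hk
  · simp [logOdds, siteProb]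
  · obtain rfl : k = 1 := hk
    simp only [logOdds, siteProb, sub_self, mul_zero, mul_one, add_zero, zero_mul, zero_sub]
    rw [← Real.log_inv, inv_div]
    congr 1
    rw [show 1 - (1 - (δ : ℝ)) / 2 = (1 + δ) / 2 by ring]
    field_simp

lemma expPotential_siteProb (δ : Set.Ioo (-1 : ℝ) 1) (χ : ℕ → ({0, 1} : Set ℝ))
    (ξ : ℕ → Set.Ioo (0 : ℝ) 1) (n : ℕ) :
    expPotential (fun n => siteProb δ (χ n) (ξ n)) n =
      Real.exp (∑ k ∈ Finset.range n, ((1 - (χ (k + 1) : ℝ)) * logOdds (ξ (k + 1)) -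
        Real.log ((1 + (δ : ℝ)) / (1 - (δ : ℝ))) * (χ (k + 1) : ℝ))) := by
  rw [expPotential]
  simp only [logOdds_siteProb]

theorem theorem3 {Ω : Type*} [MeasurableSpace Ω] (P : Measure Ω) [IsProbabilityMeasure P]
    (δ : Set.Ioo (-1 : ℝ) 1) (α β c : ℝ) (φ : ℕ → Set.Icc (0 : ℝ) 1)
    (χ : ℕ → Ω → ({0, 1} : Set ℝ)) (ξ : ℕ → Ω → Set.Ioo (0 : ℝ) 1)
    -- the `χ n` are independent with `P [χ n = 1] = φ n`
    (hχ_meas : ∀ n, Measurable (χ n))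
    (hχ_indep : iIndepFun χ P)
    (hχ_law : ∀ n, P.real {ω | (χ n ω : ℝ) = 1} = φ n)
    -- the `ξ n` are i.i.d.
    (hξ_meas : ∀ n, Measurable (ξ n))
    (hξ_indep : iIndepFun ξ P)
    (hξ_ident : ∀ n, IdentDistrib (ξ n) (ξ 0) P P)
    -- the two sequences are independent of each other
    (hξχ : IndepFun (fun ω n => ξ n ω) (fun ω n => χ n ω) P)
    -- `ζ 0 = log (ξ 0 / (1 - ξ 0))` is symmetric
    (hS : ∀ x : ℝ, 0 ≤ x →
      P.real {ω | logOdds (ξ 0 ω) ≤ -x} = P.real {ω | x ≤ logOdds (ξ 0 ω)})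
    -- and has a polynomial tail
    (hα : α ∈ Set.Ioo (1 : ℝ) 2) (hc : 0 < c)
    (htail : (fun r : ℝ => P.real {ω | r < logOdds (ξ 0 ω)}) ~[atTop]
      (fun r : ℝ => c * r ^ (-α)))
    -- the density of fast points
    (hβ : β ∈ Set.Ioo (0 : ℝ) 1)
    (hφ : ∀ n : ℕ, 1 ≤ n → (φ n : ℝ) = (n : ℝ) ^ (-β)) :
    (β < 1 - 1 / α →
      ((δ : ℝ) < 0 →
        ∀ᵐ ω ∂P, ChainRecurrent (walkKernel fun n => siteProb δ (χ n ω) (ξ n ω))) ∧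
      (0 < (δ : ℝ) →
        ∀ᵐ ω ∂P, ChainTransient (walkKernel fun n => siteProb δ (χ n ω) (ξ n ω)))) ∧
    (1 - 1 / α < β →
      ∀ᵐ ω ∂P, ChainRecurrent (walkKernel fun n => siteProb δ (χ n ω) (ξ n ω))) := by
  -- The sites are shifted by one, because the state `0` does not enter the potential.
  set l : ℝ := Real.log ((1 + (δ : ℝ)) / (1 - (δ : ℝ))) with hl
  set a : ℕ → Ω → ℝ := fun n ω => (χ (n + 1) ω : ℝ) with ha_def
  set V : ℕ → Ω → ℝ := fun n ω => logOdds (ξ (n + 1) ω) with hV_def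
  set U : ℕ → Ω → ℝ := fun n ω => (1 - a n ω) * V n ω with hU_def
  have hpot : ∀ ω n, expPotential (fun n => siteProb δ (χ n ω) (ξ n ω)) n =
      Real.exp (∑ k ∈ Finset.range n, (U k ω - l * a k ω)) := fun ω n =>
    expPotential_siteProb δ (fun n => χ n ω) (fun n => ξ n ω) n
  have hζm : ∀ n, Measurable fun ω => logOdds (ξ n ω) := fun n =>
    measurable_logOdds.comp (hξ_meas n)
  have ham : ∀ n, Measurable (a n) := fun n => measurable_subtype_coe.comp (hχ_meas (n + 1))
  have hVm : ∀ n, Measurable (V n) := fun n => hζm (n + 1)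
  have hUm : ∀ n, Measurable (U n) := fun n => (measurable_const.sub (ham n)).mul (hVm n)
  have ha : ∀ n ω, a n ω = 0 ∨ a n ω = 1 := fun n ω => (χ (n + 1) ω).2
  have haU : ∀ n ω, a n ω * U n ω = 0 := by
    intro n ω
    rcases ha n ω with h | h <;> simp [hU_def, h]
  have hUV : ∀ n ω, |U n ω| ≤ |V n ω| := by
    intro n ω
    rcases ha n ω with h | h <;> simp [hU_def, h]
  have hind : iIndepFun (fun n ω => (a n ω, U n ω)) P := by
    have h := (iIndepFun_prodMk hξ_indep hχ_indep hξ_meas hχ_meas hξχ).precomp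
      (g := fun n : ℕ => n + 1) (add_left_injective 1)
    refine h.comp (fun _ (x : Set.Ioo (0 : ℝ) 1 × ({0, 1} : Set ℝ)) =>
      ((x.2 : ℝ), (1 - (x.2 : ℝ)) * logOdds x.1)) fun _ => ?_
    have h1 : Measurable fun x : Set.Ioo (0 : ℝ) 1 × ({0, 1} : Set ℝ) => (x.2 : ℝ) :=
      measurable_subtype_coe.comp measurable_snd
    exact h1.prodMk ((measurable_const.sub h1).mul (measurable_logOdds.comp measurable_fst))
  have hχV : ∀ n, IndepFun (a n) (V n) P := fun n =>
    (hξχ.comp (φ := fun f : ℕ → Set.Ioo (0 : ℝ) 1 => logOdds (f (n + 1)))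
      (ψ := fun f : ℕ → ({0, 1} : Set ℝ) => (f (n + 1) : ℝ))
      (measurable_logOdds.comp (measurable_pi_apply _))
      (measurable_subtype_coe.comp (measurable_pi_apply _))).symm
  have ha_prob : ∀ n : ℕ, P.real {ω | a n ω = 1} = ((n : ℝ) + 1) ^ (-β) := by
    intro n
    have h := hφ (n + 1) (by omega)
    push_cast at h
    rw [← h]
    exact hχ_law (n + 1)
  have ha_set : ∀ n, MeasurableSet {ω | a n ω = 1} := fun n =>
    ham n (measurableSet_singleton 1)
  have ha_mean : ∀ n : ℕ, ∫ ω, a n ω ∂P = ((n : ℝ) + 1) ^ (-β) := by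
    intro n
    rw [← ha_prob n, ← integral_indicator_one (ha_set n)]
    refine integral_congr_ae (Eventually.of_forall fun ω => ?_)
    rcases ha n ω with h | h <;> simp [Set.indicator, h]
  have hζV : ∀ n, IdentDistrib (V n) (fun ω => logOdds (ξ 0 ω)) P P := fun n =>
    (hξ_ident (n + 1)).comp measurable_logOdds
  have hζneg := identDistrib_neg_of_tails (hζm 0) hS
  have hVneg : ∀ n, IdentDistrib (V n) (fun ω => -V n ω) P P := fun n =>
    (hζV n).trans (hζneg.trans ((hζV n).symm.comp measurable_neg))
  have hflip : ∀ n, IdentDistrib (fun ω => (a n ω, U n ω)) (fun ω => (a n ω, -U n ω)) P P := by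
    intro n
    have h := (IdentDistrib.refl (ham n).aemeasurable).prodMk (hVneg n) (hχV n)
      ((hχV n).comp measurable_id measurable_neg)
    have h2 := h.comp (u := fun x : ℝ × ℝ => (x.1, (1 - x.1) * x.2)) (by fun_prop)
    convert h2 using 1 <;>
      ext ω <;> simp [hU_def]
  have hlow : ∀ᶠ r : ℝ in atTop, c / 2 * r ^ (-α) ≤ P.real {ω | r < logOdds (ξ 0 ω)} ∧
      P.real {ω | r < logOdds (ξ 0 ω)} ≤ 3 / 2 * c * r ^ (-α) := by
    filter_upwards [htail.isLittleO.def (show (0 : ℝ) < 1 / 2 by norm_num),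
      eventually_ge_atTop 0] with r hr hr0
    rw [Pi.sub_apply, Real.norm_eq_abs, Real.norm_eq_abs,
      abs_of_nonneg (a := c * r ^ (-α)) (by positivity)] at hr
    have := abs_le.1 hr
    exact ⟨by linarith [this.1], by linarith [this.2]⟩
  have hα0 : 0 < α := by linarith [hα.1]
  have hγ : 0 < 1 - β := by linarith [hβ.2]
  have hδ1 : 0 < 1 + (δ : ℝ) := by linarith [δ.2.1]
  have hδ2 : 0 < 1 - (δ : ℝ) := by linarith [δ.2.2]
  refine ⟨fun hlt => ?_, fun hgt => ?_⟩
  · have hαγ : 1 / (1 - β) < α := by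
      rw [div_lt_iff₀ hγ, ← div_lt_iff₀' hα0]
      linarith
    obtain ⟨q, hq1, hq2⟩ := exists_between hαγ
    have hq0 : 0 < q := (by positivity : (0 : ℝ) < 1 / (1 - β)).trans hq1
    have hVq : Integrable (fun ω => |V 0 ω| ^ q) P := by
      refine integrable_rpow_of_tail (C := 3 * c) (hVm 0).abs (fun ω => abs_nonneg _) hq0 hq2 ?_
      filter_upwards [hlow] with r hr
      have h1 : P.real {ω | r < V 0 ω} = P.real {ω | r < logOdds (ξ 0 ω)} :=
        congrArg ENNReal.toReal ((hζV 0).measure_mem_eq measurableSet_Ioi)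
      have h2 : P.real {ω | r < -V 0 ω} = P.real {ω | r < V 0 ω} :=
        congrArg ENNReal.toReal ((hVneg 0).symm.measure_mem_eq measurableSet_Ioi)
      have h3 : {ω | r < |V 0 ω|} = {ω | r < V 0 ω} ∪ {ω | r < -V 0 ω} := by
        ext ω; simp [lt_abs]
      rw [h3]
      refine (measureReal_union_le _ _).trans ?_
      linarith [hr.2]
    have hVV : ∀ n, IdentDistrib (V n) (V 0) P P := fun n => (hζV n).trans (hζV 0).symm
    have hUneg : ∀ n, IdentDistrib (U n) (fun ω => -U n ω) P P := fun n =>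
      (hflip n).comp measurable_snd
    refine ⟨fun hδ => ?_, fun hδ => ?_⟩
    · have hl0 : l < 0 := Real.log_neg (by positivity) (by rw [div_lt_one hδ2]; linarith)
      have hev := ae_eventually_sum_le_of_drift (P := P) (U := fun n ω => -U n ω) (V := V) (l := -l)
        (by linarith) hβ.1 hβ.2 hq1 (hq2.trans hα.2) ham (fun n => (hUm n).neg)
        (hind.comp (fun _ (x : ℝ × ℝ) => (x.1, -x.2)) fun _ => by fun_prop) ha
        (fun n ω => by simp [haU]) ha_mean (fun n => by simpa using (hUneg n).symm)
        (fun n ω => by simpa using hUV n ω) hVV hVq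
      filter_upwards [hev] with ω hω
      refine chainRecurrent_of_not_summable _ fun hsum => ?_
      have h1 := hsum.tendsto_atTop_zero.eventually_lt_const one_pos
      obtain ⟨n, hn1, hn2⟩ := (h1.and hω).exists
      rw [hpot, Real.exp_lt_one_iff] at hn1
      have h2 : ∑ k ∈ Finset.range n, (-U k ω - -l * a k ω) =
          -∑ k ∈ Finset.range n, (U k ω - l * a k ω) := by
        rw [← Finset.sum_neg_distrib]
        exact Finset.sum_congr rfl fun k _ => by ring
      rw [h2] at hn2
      have h3 : 0 ≤ -l / 4 * (n : ℝ) ^ (1 - β) := mul_nonneg (by linarith) (by positivity)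
      linarith
    · have hl0 : 0 < l := Real.log_pos (by rw [one_lt_div hδ2]; linarith)
      have hev := ae_eventually_sum_le_of_drift (P := P) (U := U) (V := V) hl0 hβ.1 hβ.2 hq1
        (hq2.trans hα.2) ham hUm hind ha haU ha_mean hUneg hUV hVV hVq
      filter_upwards [hev] with ω hω
      refine chainTransient_of_summable _ ?_
      refine (summable_exp_neg_mul_rpow (b := l / 4) (s := 1 - β) (by positivity)
        hγ).of_norm_bounded_eventually_nat ?_
      filter_upwards [hω] with n hn
      rw [hpot, Real.norm_eq_abs, abs_of_pos (Real.exp_pos _)]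
      exact Real.exp_le_exp.2 hn
  · obtain ⟨η, hη1, hη2⟩ := exists_between (show 1 - β < 1 / α by linarith)
    have hη0 : 0 < η := hγ.trans hη1
    have hηα : η * α < 1 := (lt_div_iff₀ hα0).1 hη2
    have hjump : ¬ Summable fun n : ℕ => P.real {ω | ((n : ℝ) + 1) ^ η < |U n ω|} := by
      intro hsum
      -- Site `1` is almost surely fast, so the probability of a slow point is bounded below only
      -- from site `2`, that is from `n = 1`, on.
      set b : ℝ := 1 - (2 : ℝ) ^ (-β) with hb
      have hb0 : 0 < b := by
        rw [hb, sub_pos]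
        exact Real.rpow_lt_one_of_one_lt_of_neg (by norm_num) (by linarith [hβ.1])
      have hlim : Tendsto (fun n : ℕ => ((n : ℝ) + 1) ^ η) atTop atTop :=
        (tendsto_rpow_atTop hη0).comp
          (tendsto_atTop_add_const_right _ _ tendsto_natCast_atTop_atTop)
      have hbound : ∀ᶠ n : ℕ in atTop, b * (c / 2) * ((n : ℝ) + 1) ^ (-(η * α)) ≤
          P.real {ω | ((n : ℝ) + 1) ^ η < |U n ω|} := by
        filter_upwards [hlim.eventually hlow, eventually_ge_atTop 1] with n hn hn1
        have h1 : P.real {ω | ((n : ℝ) + 1) ^ η < V n ω} =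
            P.real {ω | ((n : ℝ) + 1) ^ η < logOdds (ξ 0 ω)} :=
          congrArg ENNReal.toReal ((hζV n).measure_mem_eq measurableSet_Ioi)
        have h2 : b ≤ P.real {ω | a n ω = 0} := by
          have e : {ω | a n ω = 0} = {ω | a n ω = 1}ᶜ := by
            ext ω
            rcases ha n ω with h | h <;> simp [h]
          rw [e, probReal_compl_eq_one_sub (ha_set n), ha_prob, hb]
          have h3 : (2 : ℝ) ≤ (n : ℝ) + 1 := by
            have : (1 : ℝ) ≤ n := by exact_mod_cast hn1
            linarith
          have := Real.rpow_le_rpow_of_nonpos (by norm_num) h3 (show -β ≤ 0 by linarith [hβ.1])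
          linarith
        have h3 : P.real ({ω | a n ω = 0} ∩ {ω | ((n : ℝ) + 1) ^ η < V n ω}) =
            P.real {ω | a n ω = 0} * P.real {ω | ((n : ℝ) + 1) ^ η < V n ω} := by
          rw [measureReal_def, measureReal_def, measureReal_def, ← ENNReal.toReal_mul]
          exact congrArg ENNReal.toReal ((hχV n).measure_inter_preimage_eq_mul _ _
            (measurableSet_singleton 0) measurableSet_Ioi)
        have h4 : ((n : ℝ) + 1) ^ (-(η * α)) = (((n : ℝ) + 1) ^ η) ^ (-α) := by
          rw [← Real.rpow_mul (by positivity)]; ring_nf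
        calc b * (c / 2) * ((n : ℝ) + 1) ^ (-(η * α))
            = b * (c / 2 * (((n : ℝ) + 1) ^ η) ^ (-α)) := by rw [h4]; ring
          _ ≤ P.real {ω | a n ω = 0} * P.real {ω | ((n : ℝ) + 1) ^ η < V n ω} := by
              rw [h1]
              exact mul_le_mul h2 hn.1 (by positivity) measureReal_nonneg
          _ ≤ _ := by
              rw [← h3]
              refine measureReal_mono ?_
              rintro ω ⟨hω1, hω2⟩
              have hω3 : U n ω = V n ω := by
                simp only [Set.mem_ofPred_eq] at hω1
                simp [hU_def, hω1]
              simp only [Set.mem_ofPred_eq] at hω2 ⊢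
              rw [hω3]
              exact hω2.trans_le (le_abs_self _)
      have hsum2 : Summable fun n : ℕ => b * (c / 2) * ((n : ℝ) + 1) ^ (-(η * α)) := by
        refine hsum.of_norm_bounded_eventually_nat ?_
        filter_upwards [hbound] with n hn
        rwa [Real.norm_eq_abs, abs_of_nonneg (by positivity)]
      rw [summable_mul_left_iff (by positivity)] at hsum2
      have hsum3 : Summable fun n : ℕ => ((n + 1 : ℕ) : ℝ) ^ (-(η * α)) := by
        simpa using hsum2
      rw [summable_nat_add_iff 1 (f := fun n : ℕ => (n : ℝ) ^ (-(η * α))),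
        Real.summable_nat_rpow] at hsum3
      linarith
    have hns := ae_not_summable_exp_of_jumps (P := P) (l := l) hβ.2 hη1 ham hUm hind ha ha_mean
      hflip hjump
    filter_upwards [hns] with ω hω
    refine chainRecurrent_of_not_summable _ fun hsum => hω ?_
    exact hsum.congr fun n => hpot ω n
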